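/- Let $G$ be a connected (finite-dimensional, real, smooth) Lie group with Lie algebra $\mathfrak g$. Let $R$ be its solvable radical and $N$ its nilpotent radical, that is, the connected subgroups of $G$ generated by $\exp\mathfrak r$ and $\exp\mathfrak n$ respectively, where $\mathfrak r$ is the largest solvable ideal of $\mathfrak g$ and $\mathfrak n$ is the largest ideal of $\mathfrak g$ that is nilpotent as a Lie algebra. For $H\in\{G,R,N\}$ let $T(H)$ denote the largest torus (Lie subgroup isomorphic to $\mathbb R^n/\mathbb Z^n$ for some $n\ge 0$) contained in the center $Z(H)$ of $H$. Then these tori exist and coincide, as subgroups of $G$: $$T(G)=T(R)=T(N).$$ -/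

import Mathlib

open scoped Manifold ContDiff

noncomputable section

namespace LieToral

/-- The Lie bracket on the Lie algebra of a Lie group is defined in Mathlib under the regularity
assumption `minSmoothness ℝ 3`, which every smooth real Lie group satisfies. -/
instance instLieGroupMinSmoothness {d : ℕ} {G : Type*} [TopologicalSpace G]
    [ChartedSpace (EuclideanSpace ℝ (Fin d)) G] [Group G] [LieGroup (𝓡 d) ∞ G] :
    LieGroup (𝓡 d) (minSmoothness ℝ 3) G := by
  rw [minSmoothness_of_isRCLikeNormedField]
  infer_instance

/-- The nilpotent radical (nilradical) of a Lie algebra: the sum of all ideals that are nilpotent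
as Lie algebras; in finite dimension it is the largest such ideal. Mathlib's
`LieAlgebra.maxNilpotentIdeal` is a different ideal: it asks that the *whole* Lie algebra act
nilpotently on the ideal. -/
def nilradical (L : Type*) [LieRing L] [LieAlgebra ℝ L] : LieIdeal ℝ L :=
  sSup {J : LieIdeal ℝ L | LieRing.IsNilpotent J}

section LieGroup

variable {d : ℕ} {G : Type*} [TopologicalSpace G] [ChartedSpace (EuclideanSpace ℝ (Fin d)) G]
  [Group G]

/-- `IsExp X g` means `g = exp X`: the integral curve through `1` of the left-invariant vector
field with value `X` at `1` is at `g` at time `1`. -/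
def IsExp (X : GroupLieAlgebra (𝓡 d) G) (g : G) : Prop :=
  ∃ γ : ℝ → G, IsMIntegralCurve γ (mulInvariantVectorField (I := 𝓡 d) X) ∧ γ 0 = 1 ∧ γ 1 = g

/-- The connected subgroup of `G` generated by a set `𝔥` of elements of the Lie algebra, that is,
the subgroup generated by `exp 𝔥`. -/
def integralSubgroup (𝔥 : Set (GroupLieAlgebra (𝓡 d) G)) : Subgroup G :=
  Subgroup.closure {g : G | ∃ X ∈ 𝔥, IsExp X g}

/-- The solvable radical of a Lie group: the connected subgroup generated by the largest solvable
ideal of its Lie algebra. -/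
def solvableRadical (d : ℕ) (G : Type*) [TopologicalSpace G]
    [ChartedSpace (EuclideanSpace ℝ (Fin d)) G] [Group G] [LieGroup (𝓡 d) ∞ G] : Subgroup G :=
  integralSubgroup (d := d) (LieAlgebra.radical ℝ (GroupLieAlgebra (𝓡 d) G) : Set _)

/-- The nilpotent radical of a Lie group: the connected subgroup generated by the largest nilpotent
ideal of its Lie algebra. -/
def nilpotentRadical (d : ℕ) (G : Type*) [TopologicalSpace G]
    [ChartedSpace (EuclideanSpace ℝ (Fin d)) G] [Group G] [LieGroup (𝓡 d) ∞ G] : Subgroup G :=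
  integralSubgroup (d := d) (nilradical (GroupLieAlgebra (𝓡 d) G) : Set _)

/-- A subgroup `K` of a Lie group `G` is a torus if it is the image of an injective homomorphism of
Lie groups `ℝⁿ/ℤⁿ → G` for some `n` (which is automatically an isomorphism of Lie groups onto
`K`, by compactness). Such a homomorphism is given as a smooth homomorphism `ℝⁿ → G` with kernel
`ℤⁿ`. -/
def IsTorus (d : ℕ) {G : Type*} [TopologicalSpace G]
    [ChartedSpace (EuclideanSpace ℝ (Fin d)) G] [Group G] (K : Subgroup G) : Prop :=
  ∃ (n : ℕ) (f : (Fin n → ℝ) → G),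
    ContMDiff 𝓘(ℝ, Fin n → ℝ) (𝓡 d) ∞ f ∧
    (∀ x y, f (x + y) = f x * f y) ∧
    (∀ x, f x = 1 ↔ ∀ i, ∃ m : ℤ, x i = m) ∧
    Set.range f = (K : Set G)

/-- The center `Z(H)` of a subgroup `H` of `G`, as a subgroup of `G`. -/
def centerOf {G : Type*} [Group G] (H : Subgroup G) : Subgroup G :=
  (Subgroup.center H).map H.subtype

/-- `T(H)`, the toral component of a subgroup `H` of `G`: the subgroup generated by all tori
contained in the center of `H`. It is the largest such torus as soon as it is a torus. -/
def toralComponent (d : ℕ) {G : Type*} [TopologicalSpace G]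
    [ChartedSpace (EuclideanSpace ℝ (Fin d)) G] [Group G] (H : Subgroup G) : Subgroup G :=
  sSup {K : Subgroup G | IsTorus d K ∧ K ≤ centerOf H}

end LieGroup

end LieToral

end

/-! Three facts carry the proof. First, a commutative subgroup contains a largest torus
(`exists_isTorus_upperBound`): the product of two commuting tori is again a torus, and dimension
bounds the growth. So `toralComponent d H` is a torus for every subgroup `H`.

Second, tori are rigid (`IsTorus.le_center`): a connected group normalizing a torus permutes the
finite set of its `m`-torsion points continuously, hence fixes each of them, hence centralizes the
torus because torsion is dense. If `H` is normal, its largest central torus is invariant under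
conjugation, so it lies in the center of `G`. The two radicals are normal because the ideals
defining them are stable under `Ad`.

Third, a central torus lies in the nilpotent radical (`IsTorus.le_nilpotentRadical`): a central
one-parameter subgroup has its direction in the center of the Lie algebra (`IsLieHom.lie_eq_zero`),
and this center is a nilpotent ideal.

Hence T(G) = T(H) for every normal `H` containing the nilpotent radical (`toralComponent_top_eq`).
-/

noncomputable section

namespace LieToral

open Set Filter Topology

/-! ### Smooth homomorphisms from vector spaces and one-parameter subgroups. -/

section Preliminaries

/-- A space locally modelled on a `T1` space is `T1`. -/
theorem t1Space_of_chartedSpace (H M : Type*) [TopologicalSpace H] [T1Space H]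
    [TopologicalSpace M] [ChartedSpace H M] : T1Space M := by
  rw [t1Space_iff_exists_open]
  intro x y hxy
  by_cases hy : y ∈ (chartAt H x).source
  · refine ⟨(chartAt H x).source ∩ chartAt H x ⁻¹' {chartAt H x y}ᶜ,
      (chartAt H x).isOpen_inter_preimage isOpen_compl_singleton,
      ⟨mem_chart_source H x, fun h => hxy ?_⟩, fun h => h.2 rfl⟩
    exact (chartAt H x).injOn (mem_chart_source H x) hy h
  · exact ⟨_, (chartAt H x).open_source, mem_chart_source H x, hy⟩

/-- The chain rule for derivatives given as maps between the model spaces. -/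
theorem hasMFDerivAt_comp_of_eq {E E' E'' H H' H'' M M' M'' : Type*}
    [NormedAddCommGroup E] [NormedSpace ℝ E] [NormedAddCommGroup E'] [NormedSpace ℝ E']
    [NormedAddCommGroup E''] [NormedSpace ℝ E''] [TopologicalSpace H] [TopologicalSpace H']
    [TopologicalSpace H''] {I : ModelWithCorners ℝ E H} {I' : ModelWithCorners ℝ E' H'}
    {I'' : ModelWithCorners ℝ E'' H''} [TopologicalSpace M] [ChartedSpace H M]
    [TopologicalSpace M'] [ChartedSpace H' M'] [TopologicalSpace M''] [ChartedSpace H'' M'']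
    {g : M' → M''} {f : M → M'} {x : M} {y : M'} {g' : E' →L[ℝ] E''} {f' : E →L[ℝ] E'}
    (hg : HasMFDerivAt I' I'' g y g') (hf : HasMFDerivAt I I' f x f') (hy : f x = y) :
    HasMFDerivAt I I'' (fun z => g (f z)) x (g'.comp f') := by
  subst hy
  exact hg.comp x hf

variable {d : ℕ} {G : Type*} [TopologicalSpace G] [ChartedSpace (EuclideanSpace ℝ (Fin d)) G]
  [Group G]

/-- A smooth group homomorphism from a vector space to `G`. -/
structure IsLieHom (d : ℕ) {G : Type*} [TopologicalSpace G]
    [ChartedSpace (EuclideanSpace ℝ (Fin d)) G] [Group G] {E : Type*} [NormedAddCommGroup E]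
    [NormedSpace ℝ E] (f : E → G) : Prop where
  contMDiff : ContMDiff 𝓘(ℝ, E) (𝓡 d) ∞ f
  map_add : ∀ x y, f (x + y) = f x * f y

/-- The derivative at `0` of a map from a vector space to a Lie group. -/
def derivZero (d : ℕ) {G : Type*} [TopologicalSpace G]
    [ChartedSpace (EuclideanSpace ℝ (Fin d)) G] {E : Type*} [NormedAddCommGroup E]
    [NormedSpace ℝ E] (f : E → G) : E →L[ℝ] EuclideanSpace ℝ (Fin d) :=
  mfderiv 𝓘(ℝ, E) (𝓡 d) f 0

namespace IsLieHom

variable {E F : Type*} [NormedAddCommGroup E] [NormedSpace ℝ E] [NormedAddCommGroup F]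
  [NormedSpace ℝ F] {f : E → G}

theorem map_zero (hf : IsLieHom d f) : f 0 = 1 := by
  have := hf.map_add 0 0
  simpa using this

theorem map_neg (hf : IsLieHom d f) (x : E) : f (-x) = (f x)⁻¹ := by
  rw [eq_inv_iff_mul_eq_one, ← hf.map_add, neg_add_cancel, hf.map_zero]

theorem map_nsmul (hf : IsLieHom d f) (m : ℕ) (x : E) : f (m • x) = f x ^ m := by
  induction m with
  | zero => simp [hf.map_zero]
  | succ m ih => rw [succ_nsmul, hf.map_add, ih, pow_succ]

theorem comp_linear (hf : IsLieHom d f) (L : F →L[ℝ] E) : IsLieHom d (f ∘ L) where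
  contMDiff := hf.contMDiff.comp L.contMDiff
  map_add x y := by simp [hf.map_add]

theorem hasMFDerivAt (hf : IsLieHom d f) :
    HasMFDerivAt 𝓘(ℝ, E) (𝓡 d) f 0 (derivZero (E := E) d f) :=
  (hf.contMDiff.contMDiffAt.mdifferentiableAt (by simp)).hasMFDerivAt

theorem derivZero_comp_linear (hf : IsLieHom d f) (L : F →L[ℝ] E) :
    derivZero d (f ∘ L) = (derivZero d f).comp L := by
  have h := hasMFDerivAt_comp_of_eq hf.hasMFDerivAt (L.hasFDerivAt (x := 0)).hasMFDerivAt
    L.map_zero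
  exact h.mfderiv

/-- The kernel of a homomorphism with injective derivative is discrete. -/
theorem eventually_ne_one (hf : IsLieHom d f) [FiniteDimensional ℝ E]
    (h : Function.Injective (derivZero d f)) : ∀ᶠ x in 𝓝[≠] (0 : E), f x ≠ 1 := by
  have h1 := hf.hasMFDerivAt.2.hasFDerivAt (by simp)
  have h2 : ∃ C, AntilipschitzWith C (derivZero d f) := by
    obtain ⟨K, -, hK⟩ := (derivZero d f).exists_antilipschitzWith (LinearMap.ker_eq_bot.2 h)
    exact ⟨K, hK⟩
  -- The derivative is read in the chart at `f 0`, so the value to avoid is the coordinate of `1` in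
  -- that chart.
  have h3 := h1.eventually_ne (c := extChartAt (𝓡 d) (f 0) 1) h2
  filter_upwards [h3] with x hx h
  refine hx ?_
  rw [← h]
  rfl

end IsLieHom

theorem isTopologicalGroup_of_lieGroup (d : ℕ) (G : Type*) [TopologicalSpace G]
    [ChartedSpace (EuclideanSpace ℝ (Fin d)) G] [Group G] [LieGroup (𝓡 d) ∞ G] :
    IsTopologicalGroup G :=
  topologicalGroup_of_lieGroup (𝓡 d) ∞

/-- Charts give `T1`, and a `T1` topological group is Hausdorff. Uniqueness of integral curves and
closedness of centralizers rest on this. -/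
theorem t2Space_of_lieGroup (d : ℕ) (G : Type*) [TopologicalSpace G]
    [ChartedSpace (EuclideanSpace ℝ (Fin d)) G] [Group G] [LieGroup (𝓡 d) ∞ G] :
    T2Space G := by
  have := isTopologicalGroup_of_lieGroup d G
  have := t1Space_of_chartedSpace (EuclideanSpace ℝ (Fin d)) G
  infer_instance

variable [LieGroup (𝓡 d) ∞ G]

/-- One-parameter curves with the same initial direction agree. -/
theorem isMIntegralCurve_mulInvariantVectorField_unique {X : GroupLieAlgebra (𝓡 d) G}
    {γ γ' : ℝ → G} (hγ : IsMIntegralCurve γ (mulInvariantVectorField (I := 𝓡 d) X))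
    (hγ' : IsMIntegralCurve γ' (mulInvariantVectorField (I := 𝓡 d) X)) (h : γ 0 = γ' 0) :
    γ = γ' := by
  have := t2Space_of_lieGroup d G
  have : IsManifold (𝓡 d) 1 G := IsManifold.of_le (n := ∞) (by norm_cast)
  refine isMIntegralCurve_Ioo_eq_of_contMDiff_boundaryless (t₀ := 0) ?_ hγ hγ' h
  refine (contMDiff_mulInvariantVectorField X).of_le ?_
  rw [minSmoothness_of_isRCLikeNormedField]
  norm_num

theorem hasMFDerivAt_mul_left (g : G) :
    HasMFDerivAt (𝓡 d) (𝓡 d) (fun x => g * x) 1 (mfderiv (𝓡 d) (𝓡 d) (fun x => g * x) 1) :=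
  ((contMDiff_mul_left (I := 𝓡 d) (n := ∞)).contMDiffAt.mdifferentiableAt (by simp)).hasMFDerivAt

namespace IsLieHom

variable {E F : Type*} [NormedAddCommGroup E] [NormedSpace ℝ E] [NormedAddCommGroup F]
  [NormedSpace ℝ F] {f : E → G}

/-- Since `f (z • x) = f (t • x) * f ((z - t) • x)`, the velocity at time `t` is the left translate
of the velocity at time `0`. -/
theorem isMIntegralCurve (hf : IsLieHom d f) (x : E) :
    IsMIntegralCurve (fun t : ℝ => f (t • x))
      (mulInvariantVectorField (I := 𝓡 d) (derivZero d f x : GroupLieAlgebra (𝓡 d) G)) := by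
  intro t
  have h1 : HasMFDerivAt 𝓘(ℝ, ℝ) 𝓘(ℝ, E) (fun s : ℝ => (s - t) • x) t
      ((1 : ℝ →L[ℝ] ℝ).smulRight x) := by
    have : HasFDerivAt (fun s : ℝ => (s - t) • x) ((1 : ℝ →L[ℝ] ℝ).smulRight x) t :=
      ((1 : ℝ →L[ℝ] ℝ).hasFDerivAt.sub_const t).smul_const x
    exact this.hasMFDerivAt
  have h2 := hasMFDerivAt_comp_of_eq hf.hasMFDerivAt h1 (by simp)
  have h3 := hasMFDerivAt_comp_of_eq (hasMFDerivAt_mul_left (f (t • x))) h2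
    (by simp [hf.map_zero])
  have h4 : (fun z : ℝ => f (t • x) * f ((z - t) • x)) = fun z => f (z • x) := by
    funext z
    rw [← hf.map_add, ← add_smul, add_sub_cancel]
  rw [h4] at h3
  refine h3.congr_mfderiv (ContinuousLinearMap.ext fun s : ℝ => ?_)
  have h5 := map_smul ((mfderiv (𝓡 d) (𝓡 d) (fun y => f (t • x) * y) 1 :
    EuclideanSpace ℝ (Fin d) →L[ℝ] EuclideanSpace ℝ (Fin d)).comp (derivZero d f)) s x
  exact h5

/-- Uniqueness of one-parameter subgroups, evaluated at time `1`. It turns inclusions between ranges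
of derivatives into inclusions between images. -/
theorem eq_of_derivZero_eq {f' : F → G} (hf : IsLieHom d f) (hf' : IsLieHom d f') {x : E}
    {y : F} (h : derivZero d f x = derivZero d f' y) : f x = f' y := by
  have h1 := hf.isMIntegralCurve x
  rw [h] at h1
  have := congrFun (isMIntegralCurve_mulInvariantVectorField_unique h1 (hf'.isMIntegralCurve y)
    (by simp [hf.map_zero, hf'.map_zero])) 1
  simpa using this

theorem isExp (hf : IsLieHom d f) (x : E) :
    IsExp (derivZero d f x : GroupLieAlgebra (𝓡 d) G) (f x) :=
  ⟨_, hf.isMIntegralCurve x, by simp [hf.map_zero], by simp⟩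

end IsLieHom

end Preliminaries

/-! ### Tori as images of homomorphisms with spanning kernel; the largest torus. -/

section Tori

variable {d : ℕ} {G : Type*} [TopologicalSpace G] [ChartedSpace (EuclideanSpace ℝ (Fin d)) G]
  [Group G]

namespace IsLieHom

variable {E F : Type*} [NormedAddCommGroup E] [NormedSpace ℝ E] [NormedAddCommGroup F]
  [NormedSpace ℝ F] {f : E → G}

/-- The kernel of a homomorphism from a vector space to a Lie group. -/
def ker (hf : IsLieHom d f) : AddSubgroup E where
  carrier := {x | f x = 1}
  add_mem' {x y} hx hy := by simp_all [hf.map_add]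
  zero_mem' := hf.map_zero
  neg_mem' {x} hx := by simp_all [hf.map_neg]

/-- The image of a homomorphism from a vector space to a Lie group. -/
def range (hf : IsLieHom d f) : Subgroup G where
  carrier := Set.range f
  mul_mem' := by
    rintro _ _ ⟨x, rfl⟩ ⟨y, rfl⟩
    exact ⟨x + y, hf.map_add x y⟩
  one_mem' := ⟨0, hf.map_zero⟩
  inv_mem' := by
    rintro _ ⟨x, rfl⟩
    exact ⟨-x, hf.map_neg x⟩

/-- A homomorphism with discrete cocompact kernel parametrizes a torus. -/
theorem isTorus_range_of_injective [FiniteDimensional ℝ E] (hf : IsLieHom d f)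
    (hinj : Function.Injective (derivZero d f))
    (hspan : Submodule.span ℝ (hf.ker : Set E) = ⊤) : IsTorus d hf.range := by
  let Λ : Submodule ℤ E := hf.ker.toIntSubmodule
  have hd : DiscreteTopology Λ := by
    refine discreteTopology_iff_isOpen_singleton_zero.2
      ((isOpen_singleton_iff_nhds_eq_pure _).2 ?_)
    refine le_antisymm (le_pure_iff.2 ?_) (pure_le_nhds _)
    have h := eventually_nhdsWithin_iff.1 (hf.eventually_ne_one hinj)
    have h' : Tendsto (Subtype.val : Λ → E) (𝓝 0) (𝓝 0) := continuous_subtype_val.tendsto _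
    filter_upwards [h'.eventually h] with x hx
    by_contra hne
    exact hx (fun h0 => hne (Subtype.ext h0)) x.2
  have hl : IsZLattice ℝ Λ := ⟨hspan⟩
  have := ZLattice.module_finite ℝ Λ
  have := ZLattice.module_free ℝ Λ
  -- A `ℤ`-basis of the kernel lattice is an `ℝ`-basis of `E`; in its coordinates the kernel
  -- consists of the integer vectors.
  let b := (Module.Free.chooseBasis ℤ Λ).reindex (Fintype.equivFin _)
  let c := b.ofZLatticeBasis ℝ
  let e := c.equivFun.symm.toContinuousLinearEquiv
  have he := hf.comp_linear e.toContinuousLinearMap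
  refine ⟨_, f ∘ e, he.contMDiff, he.map_add, ?_, ?_⟩
  · intro x
    have h1 : f (e x) = 1 ↔ e x ∈ Λ := Iff.rfl
    simp only [Function.comp_apply]
    have h3 : e x ∈ Λ ↔ e x ∈ Submodule.span ℤ (Set.range c) := by
      rw [b.ofZLatticeBasis_span ℝ Λ]
    have h4 : ∀ i, c.repr (e x) i = x i := congrFun (c.equivFun.apply_symm_apply x)
    rw [h1, h3, c.mem_span_iff_repr_mem ℤ]
    simp [h4, eq_comm]
  · exact e.surjective.range_comp f

/-- Discreteness of the kernel can be dropped: `f` factors through the projection `p` onto a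
complement `W` of the kernel of its derivative, and on `W` the derivative is injective. The image is
unchanged, and `p` carries a spanning kernel to a spanning kernel. -/
theorem isTorus_range [LieGroup (𝓡 d) ∞ G] [FiniteDimensional ℝ E] (hf : IsLieHom d f)
    (hspan : Submodule.span ℝ (hf.ker : Set E) = ⊤) : IsTorus d hf.range := by
  obtain ⟨W, hW⟩ := Submodule.exists_isCompl (LinearMap.ker (derivZero d f).toLinearMap)
  have hfW := hf.comp_linear W.subtypeL
  let p := W.projectionOnto _ hW.symm
  have hp : ∀ x, f (p x) = f x := by
    intro x
    refine hf.eq_of_derivZero_eq hf ?_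
    have : derivZero d f (x - p x) = 0 := Submodule.sub_projection_mem hW.symm x
    rw [map_sub, sub_eq_zero] at this
    exact this.symm
  have hr : hfW.range = hf.range := by
    ext g
    constructor
    · rintro ⟨x, rfl⟩
      exact ⟨x, rfl⟩
    · rintro ⟨x, rfl⟩
      exact ⟨p x, hp x⟩
  rw [← hr]
  apply hfW.isTorus_range_of_injective
  · rw [injective_iff_map_eq_zero, hf.derivZero_comp_linear]
    intro x hx
    have : (x : E) ∈ LinearMap.ker (derivZero d f).toLinearMap := hx
    simpa using (Submodule.disjoint_def.1 hW.disjoint _ this x.2)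
  · have h1 : p '' hf.ker ⊆ hfW.ker := by
      rintro _ ⟨x, hx, rfl⟩
      exact (hp x).trans hx
    rw [eq_top_iff]
    refine le_trans ?_ (Submodule.span_mono h1)
    rw [← Submodule.map_span, hspan, Submodule.map_top]
    exact (Submodule.range_projectionOnto hW.symm).ge

end IsLieHom

/-- Together with `IsLieHom.isTorus_range`, this replaces "kernel equal to `ℤⁿ`" by "kernel spans",
a condition that passes to products of homomorphisms even when the two images meet. -/
theorem IsTorus.exists_isLieHom {K : Subgroup G} (hK : IsTorus d K) :
    ∃ (n : ℕ) (f : (Fin n → ℝ) → G) (hf : IsLieHom d f),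
      Submodule.span ℝ (hf.ker : Set (Fin n → ℝ)) = ⊤ ∧ hf.range = K := by
  obtain ⟨n, f, hs, ha, hk, hr⟩ := hK
  refine ⟨n, f, ⟨hs, ha⟩, ?_, SetLike.coe_injective hr⟩
  rw [eq_top_iff, ← (Pi.basisFun ℝ (Fin n)).span_eq]
  refine Submodule.span_mono ?_
  rintro _ ⟨i, rfl⟩
  refine (hk _).2 fun j => ?_
  by_cases h : j = i
  · exact ⟨1, by simp [h]⟩
  · exact ⟨0, by simp [h]⟩

theorem mem_centerOf {G : Type*} [Group G] {H : Subgroup G} {g : G} :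
    g ∈ centerOf H ↔ g ∈ H ∧ ∀ h ∈ H, h * g = g * h := by
  simp only [centerOf, Subgroup.mem_map, Subgroup.mem_center_iff, Subgroup.coe_subtype]
  constructor
  · rintro ⟨x, hx, rfl⟩
    exact ⟨x.2, fun h hh => congrArg Subtype.val (hx ⟨h, hh⟩)⟩
  · rintro ⟨hg, h⟩
    exact ⟨⟨g, hg⟩, fun x => Subtype.ext (h x x.2), rfl⟩

theorem IsTorus.le_toralComponent {K H : Subgroup G} (hK : IsTorus d K) (h : K ≤ centerOf H) :
    K ≤ toralComponent d H :=
  le_sSup ⟨hK, h⟩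

variable [LieGroup (𝓡 d) ∞ G]

theorem IsLieHom.mul {E F : Type*} [NormedAddCommGroup E] [NormedSpace ℝ E]
    [NormedAddCommGroup F] [NormedSpace ℝ F] {f : E → G} {f' : F → G} (hf : IsLieHom d f)
    (hf' : IsLieHom d f') (hc : ∀ x y, Commute (f x) (f' y)) :
    IsLieHom d (fun z : E × F => f z.1 * f' z.2) where
  contMDiff := (hf.comp_linear (.fst ℝ E F)).contMDiff.mul (hf'.comp_linear (.snd ℝ E F)).contMDiff
  map_add x y := by
    simp only [Prod.fst_add, Prod.snd_add, hf.map_add, hf'.map_add]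
    exact (hc y.1 x.2).mul_mul_mul_comm _ _

/-- A commutative subgroup contains a largest torus. -/
theorem exists_isTorus_upperBound {C : Subgroup G} (hC : ∀ x ∈ C, ∀ y ∈ C, Commute x y) :
    ∃ T : Subgroup G, IsTorus d T ∧ T ≤ C ∧ ∀ K : Subgroup G, IsTorus d K → K ≤ C → K ≤ T := by
  -- The tangent spaces at `1` of the tori in `C`. A maximal one exists by finite dimension, and its
  -- torus is the largest.
  let S : Set (Submodule ℝ (EuclideanSpace ℝ (Fin d))) := {V |
    ∃ (E : Type) (_ : NormedAddCommGroup E) (_ : NormedSpace ℝ E) (_ : FiniteDimensional ℝ E)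
      (f : E → G) (hf : IsLieHom d f), Submodule.span ℝ (hf.ker : Set E) = ⊤ ∧ hf.range ≤ C ∧
        V = LinearMap.range (derivZero d f).toLinearMap}
  have hS : S.Nonempty := by
    refine ⟨_, (Fin 0 → ℝ), inferInstance, inferInstance, inferInstance, fun _ => 1,
      ⟨contMDiff_const, by simp⟩, Subsingleton.elim _ _, ?_, rfl⟩
    rintro _ ⟨x, rfl⟩
    exact C.one_mem
  obtain ⟨V, ⟨E, _, _, _, f, hf, hspan, hfC, hV⟩, hmax⟩ := wellFounded_gt.has_min S hS
  refine ⟨hf.range, hf.isTorus_range hspan, hfC, fun K hK hKC => ?_⟩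
  obtain ⟨n, f', hf', hspan', rfl⟩ := hK.exists_isLieHom
  have hF := hf.mul hf' fun x y => hC _ (hfC ⟨x, rfl⟩) _ (hKC ⟨y, rfl⟩)
  set F := fun z : E × (Fin n → ℝ) => f z.1 * f' z.2 with hFdef
  have hl : F ∘ (ContinuousLinearMap.inl ℝ E (Fin n → ℝ)) = f := by
    funext x
    simp [F, hf'.map_zero]
  have hr : F ∘ (ContinuousLinearMap.inr ℝ E (Fin n → ℝ)) = f' := by
    funext x
    simp [F, hf.map_zero]
  have hl' := hF.derivZero_comp_linear (.inl ℝ E (Fin n → ℝ))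
  have hr' := hF.derivZero_comp_linear (.inr ℝ E (Fin n → ℝ))
  rw [hl] at hl'
  rw [hr] at hr'
  have hmem : LinearMap.range (derivZero d F).toLinearMap ∈ S := by
    refine ⟨_, _, _, inferInstance, F, hF, ?_, ?_, rfl⟩
    · rw [eq_top_iff, ← LinearMap.sup_range_inl_inr, LinearMap.range_eq_map,
        LinearMap.range_eq_map, ← hspan, ← hspan', Submodule.map_span, Submodule.map_span,
        sup_le_iff]
      constructor <;> refine Submodule.span_mono ?_
      · rintro _ ⟨x, hx, rfl⟩
        exact (congrFun hl x).trans hx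
      · rintro _ ⟨x, hx, rfl⟩
        exact (congrFun hr x).trans hx
    · rintro _ ⟨x, rfl⟩
      exact C.mul_mem (hfC ⟨_, rfl⟩) (hKC ⟨_, rfl⟩)
  have hle : V ≤ LinearMap.range (derivZero d F).toLinearMap := by
    rw [hV, hl']
    rintro _ ⟨x, rfl⟩
    exact ⟨_, rfl⟩
  -- By maximality, multiplying by `K` adds no tangent direction; so every direction of `K` is one
  -- of `f`, and uniqueness of one-parameter subgroups places `K` in the image of `f`.
  have heq : V = LinearMap.range (derivZero d F).toLinearMap := by
    by_contra hne
    exact hmax _ hmem (lt_of_le_of_ne hle hne)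
  rintro _ ⟨y, rfl⟩
  have hy : derivZero d f' y ∈ V := by
    rw [heq, hr']
    exact ⟨_, rfl⟩
  rw [hV] at hy
  obtain ⟨x, hx⟩ := hy
  exact ⟨x, hf.eq_of_derivZero_eq hf' hx⟩

/-- The toral component of any subgroup is the largest torus in its center. -/
theorem isTorus_toralComponent (d : ℕ) {G : Type*} [TopologicalSpace G]
    [ChartedSpace (EuclideanSpace ℝ (Fin d)) G] [Group G] [LieGroup (𝓡 d) ∞ G] (H : Subgroup G) :
    IsTorus d (toralComponent d H) ∧ toralComponent d H ≤ centerOf H := by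
  obtain ⟨T, hT, hTH, hmax⟩ := exists_isTorus_upperBound (d := d) (C := centerOf H)
    fun x hx y hy => ((mem_centerOf.1 hy).2 x (mem_centerOf.1 hx).1)
  have : toralComponent d H = T :=
    le_antisymm (sSup_le fun K hK => hmax K hK.1 hK.2) (le_sSup ⟨hT, hTH⟩)
  rw [this]
  exact ⟨hT, hTH⟩

end Tori

/-! ### Rigidity of tori under conjugation by a connected group. -/

section Rigidity

/-- A continuous map from a connected space with finite image in a `T1` space is constant. -/
theorem eq_of_finite_range {X Y : Type*} [TopologicalSpace X] [PreconnectedSpace X]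
    [TopologicalSpace Y] [T1Space Y] {f : X → Y} (hf : Continuous f) {s : Set Y} (hs : s.Finite)
    (h : ∀ x, f x ∈ s) (x y : X) : f x = f y := by
  have h1 : IsPreconnected (range f) := isPreconnected_range hf
  have h2 : (range f).Finite := hs.subset (by rintro _ ⟨x, rfl⟩; exact h x)
  by_contra hne
  exact h1.infinite_of_nontrivial ⟨_, ⟨x, rfl⟩, _, ⟨y, rfl⟩, hne⟩ h2

variable {d : ℕ} {G : Type*} [TopologicalSpace G] [ChartedSpace (EuclideanSpace ℝ (Fin d)) G]
  [Group G]

/-- The torsion of a torus is finite in each order. -/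
theorem IsTorus.finite_torsion {K : Subgroup G} (hK : IsTorus d K) {m : ℕ} (hm : 0 < m) :
    {g ∈ K | g ^ m = 1}.Finite := by
  obtain ⟨n, f, hs, ha, hk, hr⟩ := hK
  have hf : IsLieHom d f := ⟨hs, ha⟩
  -- If `f x` is `m`-torsion, then `m • x` is an integer vector `z`, and modulo `ℤⁿ` the point `x`
  -- equals `r / m` with `r` the residue of `z`.
  refine (Set.finite_range fun r : Fin n → Fin m => f fun i => (r i : ℝ) / m).subset ?_
  rintro g ⟨hg, hgm⟩
  obtain ⟨x, rfl⟩ : g ∈ Set.range f := hr ▸ hg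
  rw [← hf.map_nsmul, hk] at hgm
  choose z hz using hgm
  have hm' : (0 : ℤ) < m := by exact_mod_cast hm
  have hm0 : (m : ℝ) ≠ 0 := by positivity
  refine ⟨fun i => ⟨(z i % m).toNat, ?_⟩, ?_⟩
  · have := Int.emod_lt_of_pos (z i) hm'
    omega
  · rw [← inv_mul_eq_one, ← hf.map_neg, ← hf.map_add, hk]
    intro i
    refine ⟨z i / m, ?_⟩
    have h1 : ((z i % m).toNat : ℝ) = ((z i % m : ℤ) : ℝ) := by
      exact_mod_cast congrArg (Int.cast (R := ℝ)) (Int.toNat_of_nonneg (Int.emod_nonneg _ hm'.ne'))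
    have h2 : ((z i % m : ℤ) : ℝ) + m * ((z i / m : ℤ) : ℝ) = z i := by
      exact_mod_cast Int.emod_add_mul_ediv (z i) m
    have h3 : (m : ℝ) * x i = z i := by simpa using hz i
    simp only [Pi.add_apply, Pi.neg_apply, h1]
    field_simp
    linarith

/-- The torsion of a torus is dense. -/
theorem IsTorus.subset_closure_torsion {K : Subgroup G} (hK : IsTorus d K) :
    (K : Set G) ⊆ closure {g ∈ K | ∃ m > 0, g ^ m = 1} := by
  obtain ⟨n, f, hs, ha, hk, hr⟩ := hK
  have hf : IsLieHom d f := ⟨hs, ha⟩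
  have hd : DenseRange fun (q : Fin n → ℚ) i => (q i : ℝ) :=
    DenseRange.piMap fun _ => Rat.denseRange_cast
  rw [← hr]
  refine (hf.contMDiff.continuous.range_subset_closure_image_dense hd).trans (closure_mono ?_)
  rintro _ ⟨_, ⟨q, rfl⟩, rfl⟩
  -- The product of the denominators clears a rational vector, so rational points map to torsion.
  refine ⟨hr.subset ⟨_, rfl⟩, ∏ i, (q i).den, Finset.prod_pos fun i _ => (q i).den_pos, ?_⟩
  rw [← hf.map_nsmul, hk]
  intro i
  obtain ⟨c, hc⟩ := Finset.dvd_prod_of_mem (fun i => (q i).den) (Finset.mem_univ i)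
  refine ⟨c * (q i).num, ?_⟩
  have h := Rat.mul_den_eq_num (q i)
  have h' : (q i : ℝ) * (q i).den = (q i).num := by exact_mod_cast h
  rw [hc]
  simp only [Pi.smul_apply, nsmul_eq_mul]
  push_cast
  rw [← h']
  ring

variable [LieGroup (𝓡 d) ∞ G]

/-- A torus normalized by a connected Lie group is central. -/
theorem IsTorus.le_center [ConnectedSpace G] {K : Subgroup G} (hK : IsTorus d K)
    (hn : ∀ g, ∀ k ∈ K, g * k * g⁻¹ ∈ K) : K ≤ Subgroup.center G := by
  have := isTopologicalGroup_of_lieGroup d G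
  have := t2Space_of_lieGroup d G
  intro k hk
  rw [Subgroup.mem_center_iff]
  intro g
  have hcl : IsClosed {k : G | g * k = k * g} :=
    isClosed_eq (by fun_prop) (by fun_prop)
  -- The centralizer of `g` is closed, so only torsion elements need checking.
  refine closure_minimal ?_ hcl (hK.subset_closure_torsion hk)
  rintro t ⟨ht, m, hm, htm⟩
  -- All conjugates of `t` are `m`-torsion in `K`, so the orbit map is constant; compare its values
  -- at `g` and `1`.
  have h := eq_of_finite_range (f := fun g : G => g * t * g⁻¹) (by fun_prop)
    (hK.finite_torsion hm) (fun g => ⟨hn g t ht, by simp [conj_pow, htm]⟩) g 1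
  have h' : g * t * g⁻¹ = t := by simpa using h
  exact mul_inv_eq_iff_eq_mul.1 h'

theorem IsTorus.conj {K : Subgroup G} (hK : IsTorus d K) (g : G) :
    IsTorus d (K.map (MulAut.conj g).toMonoidHom) := by
  obtain ⟨n, f, hs, ha, hk, hr⟩ := hK
  refine ⟨n, fun x => g * f x * g⁻¹, (contMDiff_const.mul hs).mul contMDiff_const, ?_, ?_, ?_⟩
  · intro x y
    simp [ha]
  · intro x
    rw [conj_eq_one_iff, hk]
  · rw [Subgroup.coe_map, ← hr, ← Set.range_comp]
    rfl

theorem centerOf_conj {G : Type*} [Group G] {H : Subgroup G} (hH : H.Normal) (g : G) :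
    (centerOf H).map (MulAut.conj g).toMonoidHom ≤ centerOf H := by
  rintro _ ⟨k, hk, rfl⟩
  rw [SetLike.mem_coe, mem_centerOf] at hk
  refine mem_centerOf.2 ⟨hH.conj_mem k hk.1 g, fun h hh => ?_⟩
  have h1 := hk.2 _ (hH.conj_mem h hh g⁻¹)
  simp only [MulEquiv.coe_toMonoidHom, MulAut.conj_apply]
  calc h * (g * k * g⁻¹) = g * (g⁻¹ * h * g⁻¹⁻¹ * k) * g⁻¹ := by group
    _ = g * (k * (g⁻¹ * h * g⁻¹⁻¹)) * g⁻¹ := by rw [h1]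
    _ = g * k * g⁻¹ * h := by group

/-- The toral component of a normal subgroup of a connected Lie group is central. -/
theorem toralComponent_le_center [ConnectedSpace G] {H : Subgroup G} (hH : H.Normal) :
    toralComponent d H ≤ Subgroup.center G := by
  obtain ⟨hT, hTH⟩ := isTorus_toralComponent d H
  refine hT.le_center fun g k hk => ?_
  exact (hT.conj g).le_toralComponent ((Subgroup.map_mono hTH).trans (centerOf_conj hH g))
    ⟨k, hk, rfl⟩

end Rigidity

/-! ### The adjoint action and normality of the radicals. -/

section Adjoint

variable {d : ℕ} {G : Type*} [TopologicalSpace G] [ChartedSpace (EuclideanSpace ℝ (Fin d)) G]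
  [Group G]

variable (d) in
/-- The adjoint action: the derivative of conjugation at `1`. -/
def adjoint (g : G) : GroupLieAlgebra (𝓡 d) G →L[ℝ] GroupLieAlgebra (𝓡 d) G :=
  (mfderiv (𝓡 d) (𝓡 d) (fun x : G => g * x * g⁻¹) 1 :
    EuclideanSpace ℝ (Fin d) →L[ℝ] EuclideanSpace ℝ (Fin d))

variable [LieGroup (𝓡 d) ∞ G]

theorem contMDiff_conj (g : G) : ContMDiff (𝓡 d) (𝓡 d) ∞ (fun x : G => g * x * g⁻¹) :=
  (contMDiff_const.mul contMDiff_id).mul contMDiff_const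

theorem hasMFDerivAt_conj (g x : G) :
    HasMFDerivAt (𝓡 d) (𝓡 d) (fun x : G => g * x * g⁻¹) x
      (mfderiv (𝓡 d) (𝓡 d) (fun x : G => g * x * g⁻¹) x) :=
  ((contMDiff_conj g).contMDiffAt.mdifferentiableAt (by simp)).hasMFDerivAt

/-- Arbitrary base points are allowed because pulling back vector fields needs an invertible
derivative at every point, not only at `1`. -/
theorem mfderiv_conj_conj {g h : G} (hgh : g * h = 1) {x y : G} (hxy : h * x * h⁻¹ = y) :
    (mfderiv (𝓡 d) (𝓡 d) (fun x : G => g * x * g⁻¹) y :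
      EuclideanSpace ℝ (Fin d) →L[ℝ] EuclideanSpace ℝ (Fin d)).comp
      (mfderiv (𝓡 d) (𝓡 d) (fun x : G => h * x * h⁻¹) x :
      EuclideanSpace ℝ (Fin d) →L[ℝ] EuclideanSpace ℝ (Fin d)) = .id ℝ _ := by
  have h1 := hasMFDerivAt_comp_of_eq (hasMFDerivAt_conj (d := d) g y)
    (hasMFDerivAt_conj (d := d) h x) hxy
  have h2 : (fun z : G => g * (h * z * h⁻¹) * g⁻¹) = id := by
    obtain rfl := eq_inv_of_mul_eq_one_left hgh
    funext z
    simp [mul_assoc]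
  rw [h2] at h1
  exact hasMFDerivAt_unique h1 (hasMFDerivAt_id x)

theorem adjoint_adjoint_inv (g : G) (X : GroupLieAlgebra (𝓡 d) G) :
    adjoint d g (adjoint d g⁻¹ X) = X := by
  have h := mfderiv_conj_conj (d := d) (mul_inv_cancel g) (x := 1) (y := 1) (by simp)
  exact congrArg (fun L => L X) h

/-- Conjugation maps the left-invariant field of `X` to that of `Ad X`. -/
theorem mfderiv_conj_mulInvariantVectorField (g x : G) (X : GroupLieAlgebra (𝓡 d) G) :
    mfderiv (𝓡 d) (𝓡 d) (fun x : G => g * x * g⁻¹) x (mulInvariantVectorField X x) =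
      mulInvariantVectorField (I := 𝓡 d) (adjoint d g X)
        (g * x * g⁻¹) := by
  have h1 := hasMFDerivAt_comp_of_eq (hasMFDerivAt_conj (d := d) g x)
    (hasMFDerivAt_mul_left (d := d) x) (mul_one x)
  have h2 := hasMFDerivAt_comp_of_eq (hasMFDerivAt_mul_left (d := d) (g * x * g⁻¹))
    (hasMFDerivAt_conj (d := d) g 1) (by simp)
  have h3 : (fun z : G => g * x * g⁻¹ * (g * z * g⁻¹)) = fun z => g * (x * z) * g⁻¹ := by
    funext z
    group
  rw [h3] at h2
  have h4 := hasMFDerivAt_unique h1 h2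
  exact congrArg (fun L => L X) h4

theorem isMIntegralCurve_conj {X : GroupLieAlgebra (𝓡 d) G} {γ : ℝ → G}
    (hγ : IsMIntegralCurve γ (mulInvariantVectorField (I := 𝓡 d) X)) (g : G) :
    IsMIntegralCurve (fun t => g * γ t * g⁻¹)
      (mulInvariantVectorField (I := 𝓡 d) (adjoint d g X)) := by
  intro t
  have h := (hasMFDerivAt_conj (d := d) g (γ t)).comp t (hγ t)
  refine h.congr_mfderiv (ContinuousLinearMap.ext fun s : ℝ => ?_)
  have h1 := mfderiv_conj_mulInvariantVectorField (d := d) g (γ t) X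
  have h2 := map_smul (mfderiv (𝓡 d) (𝓡 d) (fun x : G => g * x * g⁻¹) (γ t)) s
    (mulInvariantVectorField X (γ t))
  rw [h1] at h2
  exact h2

theorem IsExp.conj {X : GroupLieAlgebra (𝓡 d) G} {x : G} (h : IsExp X x) (g : G) :
    IsExp (adjoint d g X) (g * x * g⁻¹) := by
  obtain ⟨γ, h1, h2, h3⟩ := h
  exact ⟨_, isMIntegralCurve_conj h1 g, by simp [h2], by simp [h3]⟩

/-- A subgroup generated by the exponentials of an `Ad`-stable set is normal. -/
theorem integralSubgroup_normal {S : Set (GroupLieAlgebra (𝓡 d) G)}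
    (hS : ∀ (g : G), ∀ X ∈ S, (adjoint d g X) ∈ S) :
    (integralSubgroup S).Normal := by
  refine Subgroup.Normal.mk fun n hn g => ?_
  have : integralSubgroup S ≤ (integralSubgroup S).comap (MulAut.conj g).toMonoidHom := by
    refine (Subgroup.closure_le _).2 ?_
    rintro x ⟨X, hX, hx⟩
    exact Subgroup.subset_closure ⟨_, hS g X hX, hx.conj g⟩
  exact this hn

open VectorField

/-- Pullback applies the inverse of the derivative, whence `g⁻¹` on the right. -/
theorem mpullback_conj_mulInvariantVectorField (g : G) (X : GroupLieAlgebra (𝓡 d) G) :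
    mpullback (𝓡 d) (𝓡 d) (fun x : G => g * x * g⁻¹) (mulInvariantVectorField X) =
      mulInvariantVectorField (I := 𝓡 d) (adjoint d g⁻¹ X) := by
  funext x
  have h1 := mfderiv_conj_mulInvariantVectorField (d := d) g x (adjoint d g⁻¹ X)
  rw [adjoint_adjoint_inv] at h1
  have h2 : (mfderiv (𝓡 d) (𝓡 d) (fun x : G => g * x * g⁻¹) x :
      EuclideanSpace ℝ (Fin d) →L[ℝ] EuclideanSpace ℝ (Fin d)).IsInvertible := by
    exact ContinuousLinearMap.IsInvertible.of_inverse
      (mfderiv_conj_conj (d := d) (mul_inv_cancel g) (x := g * x * g⁻¹) (by group))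
      (mfderiv_conj_conj (d := d) (inv_mul_cancel g) rfl)
  rw [mpullback_apply]
  exact (h2.inverse_apply_eq).2 h1.symm

theorem mulInvariantVectorField_one (X : GroupLieAlgebra (𝓡 d) G) :
    mulInvariantVectorField X 1 = X := by
  have h1 := hasMFDerivAt_mul_left (d := d) (1 : G)
  have h2 : (fun x : G => 1 * x) = id := funext one_mul
  have h3 : mfderiv (𝓡 d) (𝓡 d) (fun x : G => 1 * x) 1 =
      ContinuousLinearMap.id ℝ (EuclideanSpace ℝ (Fin d)) := by
    rw [h2]
    exact mfderiv_id
  exact congrArg (fun L : EuclideanSpace ℝ (Fin d) →L[ℝ] EuclideanSpace ℝ (Fin d) => L X) h3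

/-- Pullback along a diffeomorphism commutes with brackets of vector fields; apply this to
conjugation and left-invariant fields, then evaluate at `1`. -/
theorem adjoint_inv_lie (g : G) (X Y : GroupLieAlgebra (𝓡 d) G) :
    adjoint d g⁻¹ ⁅X, Y⁆ = ⁅adjoint d g⁻¹ X, adjoint d g⁻¹ Y⁆ := by
  have h1 := mpullback_mlieBracket (I := 𝓡 d) (I' := 𝓡 d) (n := ∞)
    (f := fun x : G => g * x * g⁻¹) (x₀ := (1 : G))
    (mdifferentiableAt_mulInvariantVectorField X) (mdifferentiableAt_mulInvariantVectorField Y)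
    (contMDiff_conj g).contMDiffAt
    (by rw [minSmoothness_of_isRCLikeNormedField]; exact ENat.LEInfty.out)
  rw [mpullback_conj_mulInvariantVectorField, mpullback_conj_mulInvariantVectorField,
    ← mulInvariantVector_mlieBracket, mpullback_conj_mulInvariantVectorField] at h1
  rw [GroupLieAlgebra.bracket_def, GroupLieAlgebra.bracket_def, ← h1]
  exact (mulInvariantVectorField_one _).symm

theorem adjoint_lie (g : G) (X Y : GroupLieAlgebra (𝓡 d) G) :
    adjoint d g ⁅X, Y⁆ = ⁅adjoint d g X, adjoint d g Y⁆ := by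
  simpa using adjoint_inv_lie (d := d) g⁻¹ X Y

variable (d) in
/-- The adjoint action by automorphisms of the Lie algebra. -/
def adjointEquiv (g : G) : GroupLieAlgebra (𝓡 d) G ≃ₗ⁅ℝ⁆ GroupLieAlgebra (𝓡 d) G where
  toLinearMap := (adjoint d g).toLinearMap
  map_lie' := adjoint_lie g _ _
  invFun := adjoint d g⁻¹
  left_inv X := by simpa using adjoint_adjoint_inv (d := d) g⁻¹ X
  right_inv X := adjoint_adjoint_inv g X

/-- Nilpotency and solvability descend along injective homomorphisms, so both classes of ideals are
stable under automorphisms. -/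
theorem _root_.LieIdeal.exists_injective_comap {L : Type*} [LieRing L] [LieAlgebra ℝ L]
    (e : L ≃ₗ⁅ℝ⁆ L) (J : LieIdeal ℝ L) :
    ∃ f : J.comap e.toLieHom →ₗ⁅ℝ⁆ J, Function.Injective f :=
  ⟨{ toFun := fun x => ⟨e x, LieIdeal.mem_comap.1 x.2⟩
     map_add' := fun x y => by ext; simp
     map_smul' := fun c x => by ext; simp
     map_lie' := fun {x y} => Subtype.ext (e.map_lie x y) },
    fun x y h => Subtype.ext (e.injective (congrArg Subtype.val h))⟩

/-- The supremum of a class of ideals stable under automorphisms is stable under automorphisms. -/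
theorem map_mem_sSup_ideals {L : Type*} [LieRing L] [LieAlgebra ℝ L] {S : Set (LieIdeal ℝ L)}
    (hS : ∀ (e : L ≃ₗ⁅ℝ⁆ L), ∀ J ∈ S, J.comap e.toLieHom ∈ S) (e : L ≃ₗ⁅ℝ⁆ L) {x : L}
    (hx : x ∈ sSup S) : e x ∈ sSup S := by
  have h : sSup S ≤ (sSup S).comap e.toLieHom := by
    refine sSup_le fun J hJ y hy => LieIdeal.mem_comap.2 ?_
    -- For `y ∈ J`, the element `e y` lies in the pullback of `J` along `e.symm`, which again
    -- belongs to `S`.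
    refine (le_sSup (hS e.symm J hJ)) (LieIdeal.mem_comap.2 ?_)
    change e.symm (e y) ∈ J
    simpa using hy
  exact LieIdeal.mem_comap.1 (h hx)

theorem nilpotentRadical_normal : (nilpotentRadical d G).Normal := by
  refine integralSubgroup_normal fun g X hX => ?_
  refine map_mem_sSup_ideals (fun e J hJ => ?_) (adjointEquiv d g) hX
  obtain ⟨f, hf⟩ := LieIdeal.exists_injective_comap e J
  have : LieRing.IsNilpotent J := hJ
  exact hf.lieAlgebra_isNilpotent

theorem solvableRadical_normal : (solvableRadical d G).Normal := by
  refine integralSubgroup_normal fun g X hX => ?_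
  refine map_mem_sSup_ideals (fun e J hJ => ?_) (adjointEquiv d g) hX
  obtain ⟨f, hf⟩ := LieIdeal.exists_injective_comap e J
  have : LieAlgebra.IsSolvable J := hJ
  exact hf.lieAlgebra_isSolvable

end Adjoint

/-! ### Central one-parameter subgroups have central directions. -/

section Bracket

open VectorField

/-- If the left-invariant field of `X` for a local multiplication `m` coincides with the
right-invariant one, then it commutes with all left-invariant fields. -/
theorem lieBracket_eq_zero_of_left_eq_right {E : Type*} [NormedAddCommGroup E] [NormedSpace ℝ E]
    {m : E × E → E} {a : E} (hm : ContDiffAt ℝ 2 m (a, a)) {X Y : E} {V W : E → E}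
    (hV : V =ᶠ[𝓝 a] fun y => fderiv ℝ m (a, y) (X, 0)) (hVa : V a = X)
    (hW : W =ᶠ[𝓝 a] fun y => fderiv ℝ m (y, a) (0, Y)) (hWa : W a = Y) :
    lieBracketWithin ℝ V W univ a = 0 := by
  rw [lieBracketWithin_univ, lieBracket, hVa, hWa, hV.fderiv_eq, hW.fderiv_eq]
  have hd : HasFDerivAt (fderiv ℝ m) (fderiv ℝ (fderiv ℝ m) (a, a)) (a, a) :=
    ((hm.fderiv_right (m := 1) (by norm_num)).differentiableAt (by simp)).hasFDerivAt
  have h1 : HasFDerivAt (fun y : E => (a, y)) (.inr ℝ E E) a := hasFDerivAt_prodMk_right a a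
  have h2 : HasFDerivAt (fun y : E => (y, a)) (.inl ℝ E E) a := hasFDerivAt_prodMk_left a a
  have h3 := (hd.comp (f := fun y : E => (a, y)) a h1).clm_apply
    (hasFDerivAt_const ((X, 0) : E × E) a)
  have h4 := (hd.comp (f := fun y : E => (y, a)) a h2).clm_apply
    (hasFDerivAt_const ((0, Y) : E × E) a)
  -- Both terms of the bracket are the mixed second derivative of `m` at `(a, a)` in the directions
  -- `X` and `Y`, so they cancel by symmetry.
  have hsymm := hm.isSymmSndFDerivAt (by simp) (X, 0) (0, Y)
  have h3' := h3.fderiv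
  have h4' := h4.fderiv
  simp only [Function.comp_def] at h3' h4'
  rw [h3', h4']
  simpa [sub_eq_zero] using hsymm

variable {d : ℕ} {G : Type*} [TopologicalSpace G] [ChartedSpace (EuclideanSpace ℝ (Fin d)) G]
  [Group G]

variable (d G) in
/-- The multiplication of a Lie group in the chart at `1`. -/
def localMul (p : EuclideanSpace ℝ (Fin d) × EuclideanSpace ℝ (Fin d)) :
    EuclideanSpace ℝ (Fin d) :=
  extChartAt (𝓡 d) (1 : G)
    ((extChartAt (𝓡 d) (1 : G)).symm p.1 * (extChartAt (𝓡 d) (1 : G)).symm p.2)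

theorem localMul_left_one {y : EuclideanSpace ℝ (Fin d)}
    (hy : y ∈ (extChartAt (𝓡 d) (1 : G)).target) :
    localMul d G (extChartAt (𝓡 d) (1 : G) 1, y) = y := by
  simp only [localMul, extChartAt_to_inv, one_mul]
  exact (extChartAt (𝓡 d) (1 : G)).right_inv hy

variable [LieGroup (𝓡 d) ∞ G]

theorem contDiffAt_localMul {y z : EuclideanSpace ℝ (Fin d)}
    (hy : y ∈ (extChartAt (𝓡 d) (1 : G)).target) (hz : z ∈ (extChartAt (𝓡 d) (1 : G)).target)
    (hyz : (extChartAt (𝓡 d) (1 : G)).symm y * (extChartAt (𝓡 d) (1 : G)).symm z ∈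
      (extChartAt (𝓡 d) (1 : G)).source) :
    ContDiffAt ℝ ∞ (localMul d G) (y, z) := by
  rw [← contMDiffAt_iff_contDiffAt]
  have hs : ∀ y ∈ (extChartAt (𝓡 d) (1 : G)).target,
      ContMDiffAt 𝓘(ℝ, EuclideanSpace ℝ (Fin d)) (𝓡 d) ∞ (extChartAt (𝓡 d) (1 : G)).symm y :=
    fun y hy => (contMDiffOn_extChartAt_symm (1 : G)).contMDiffAt
      ((isOpen_extChartAt_target (1 : G)).mem_nhds hy)
  have h1 := (hs y hy).comp (y, z) (contDiff_fst.contMDiff (n := ∞)).contMDiffAt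
  have h2 := (hs z hz).comp (y, z) (contDiff_snd.contMDiff (n := ∞)).contMDiffAt
  exact ContMDiffAt.comp (y, z) (contMDiffAt_extChartAt' (by simpa using hyz)) (h1.mul h2)

theorem hasMFDerivAt_extChartAt_one : HasMFDerivAt (𝓡 d) 𝓘(ℝ, EuclideanSpace ℝ (Fin d))
    (extChartAt (𝓡 d) (1 : G)) 1 (.id ℝ (EuclideanSpace ℝ (Fin d))) := by
  have : IsManifold (𝓡 d) 1 G := IsManifold.of_le (n := ∞) (by norm_cast)
  have h := (mdifferentiableAt_extChartAt (I := 𝓡 d) (mem_chart_source _ (1 : G))).hasMFDerivAt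
  rw [mfderiv_extChartAt_self] at h
  exact h

theorem hasMFDerivAt_extChartAt_one_symm : HasMFDerivAt 𝓘(ℝ, EuclideanSpace ℝ (Fin d)) (𝓡 d)
    (extChartAt (𝓡 d) (1 : G)).symm (extChartAt (𝓡 d) (1 : G) 1)
    (.id ℝ (EuclideanSpace ℝ (Fin d))) := by
  have : IsManifold (𝓡 d) 1 G := IsManifold.of_le (n := ∞) (by norm_cast)
  have h := (mdifferentiableWithinAt_extChartAt_symm (I := 𝓡 d)
    (mem_extChartAt_target (1 : G))).hasMFDerivWithinAt
  rw [mfderivWithin_range_extChartAt_symm, ModelWithCorners.range_eq_univ] at h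
  exact hasMFDerivWithinAt_univ.1 h

/-- The left-invariant field at `g` is the derivative of `z ↦ g * z` at `1`; in the chart this is
the partial derivative of `localMul` in its second variable. -/
theorem mpullbackWithin_mulInvariantVectorField {y : EuclideanSpace ℝ (Fin d)}
    (hy : y ∈ (extChartAt (𝓡 d) (1 : G)).target) (X : GroupLieAlgebra (𝓡 d) G) :
    mpullbackWithin 𝓘(ℝ, EuclideanSpace ℝ (Fin d)) (𝓡 d) (extChartAt (𝓡 d) (1 : G)).symm
      (mulInvariantVectorField X) (Set.range (𝓡 d)) y =
      fderiv ℝ (localMul d G) (y, extChartAt (𝓡 d) (1 : G) 1)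
        (0, (X : EuclideanSpace ℝ (Fin d))) := by
  have : IsManifold (𝓡 d) 1 G := IsManifold.of_le (n := ∞) (by norm_cast)
  have hs := (extChartAt (𝓡 d) (1 : G)).map_target hy
  have h1 := hasMFDerivAt_comp_of_eq
    (hasMFDerivAt_mul_left (d := d) ((extChartAt (𝓡 d) (1 : G)).symm y))
    hasMFDerivAt_extChartAt_one_symm (extChartAt_to_inv _)
  have h2 := hasMFDerivAt_comp_of_eq (y := (extChartAt (𝓡 d) (1 : G)).symm y)
    (mdifferentiableAt_extChartAt (I := 𝓡 d) (x := (1 : G)) (by simpa using hs)).hasMFDerivAt h1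
    (by rw [extChartAt_to_inv, mul_one])
  have h3 := ((contDiffAt_localMul hy (mem_extChartAt_target (1 : G))
    (by simpa using hs)).differentiableAt (by simp)).hasFDerivAt.comp
      (f := fun z => (y, z)) (extChartAt (𝓡 d) (1 : G) 1) (hasFDerivAt_prodMk_right _ _)
  have h4 := hasMFDerivAt_unique h2 h3.hasMFDerivAt
  have h5 := congrArg
    (fun L : EuclideanSpace ℝ (Fin d) →L[ℝ] EuclideanSpace ℝ (Fin d) => L X) h4
  rw [mpullbackWithin_apply]
  refine ((isInvertible_mfderivWithin_extChartAt_symm hy).inverse_apply_eq).2 ?_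
  have h6 := congrArg
    (fun L : EuclideanSpace ℝ (Fin d) →L[ℝ] EuclideanSpace ℝ (Fin d) =>
      L (mulInvariantVectorField X ((extChartAt (𝓡 d) (1 : G)).symm y)))
    (mfderivWithin_extChartAt_symm_comp_mfderiv_extChartAt (I := 𝓡 d) hy)
  refine h6.symm.trans ?_
  exact congrArg (mfderivWithin 𝓘(ℝ, EuclideanSpace ℝ (Fin d)) (𝓡 d)
    (extChartAt (𝓡 d) (1 : G)).symm (Set.range (𝓡 d)) y) h5

/-- For a central one-parameter subgroup the left- and right-invariant fields agree. -/
theorem IsLieHom.fderiv_localMul_comm {E : Type*} [NormedAddCommGroup E] [NormedSpace ℝ E]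
    {f : E → G} (hf : IsLieHom d f) (hc : hf.range ≤ Subgroup.center G) (x : E)
    {y : EuclideanSpace ℝ (Fin d)} (hy : y ∈ (extChartAt (𝓡 d) (1 : G)).target) :
    fderiv ℝ (localMul d G) (y, extChartAt (𝓡 d) (1 : G) 1) (0, derivZero d f x) =
      fderiv ℝ (localMul d G) (extChartAt (𝓡 d) (1 : G) 1, y) (derivZero d f x, 0) := by
  have hs := (extChartAt (𝓡 d) (1 : G)).map_target hy
  have ha := mem_extChartAt_target (I := 𝓡 d) (1 : G)
  have hc1 := (hasMFDerivAt_comp_of_eq hasMFDerivAt_extChartAt_one hf.hasMFDerivAt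
    hf.map_zero).hasFDerivAt
  have hc2 : HasFDerivAt (fun z => extChartAt (𝓡 d) (1 : G) (f z)) (derivZero d f) 0 := hc1
  have h1 := ((contDiffAt_localMul hy ha
    (by simpa using hs)).differentiableAt (by simp)).hasFDerivAt
  have h2 := ((contDiffAt_localMul ha hy
    (by simpa using hs)).differentiableAt (by simp)).hasFDerivAt
  have h0 : extChartAt (𝓡 d) (1 : G) (f 0) = extChartAt (𝓡 d) (1 : G) 1 := by rw [hf.map_zero]
  rw [← h0] at h1 h2
  have h3 := HasFDerivAt.comp (f := fun z => (y, extChartAt (𝓡 d) (1 : G) (f z))) (0 : E) h1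
    ((hasFDerivAt_prodMk_right y _).comp 0 hc2)
  have h4 := HasFDerivAt.comp (f := fun z => (extChartAt (𝓡 d) (1 : G) (f z), y)) (0 : E) h2
    ((hasFDerivAt_prodMk_left _ y).comp 0 hc2)
  -- Since `f z` is central, the two products agree for small `z`; differentiating at `z = 0` gives
  -- the claim.
  have hev : (localMul d G ∘ fun z => (y, extChartAt (𝓡 d) (1 : G) (f z))) =ᶠ[𝓝 0]
      (localMul d G ∘ fun z => (extChartAt (𝓡 d) (1 : G) (f z), y)) := by
    have : ∀ᶠ z in 𝓝 (0 : E), f z ∈ (extChartAt (𝓡 d) (1 : G)).source := by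
      refine hf.contMDiff.continuous.continuousAt.eventually_mem ?_
      rw [hf.map_zero]
      exact extChartAt_source_mem_nhds 1
    filter_upwards [this] with z hz
    simp only [Function.comp_apply, localMul, (extChartAt (𝓡 d) (1 : G)).left_inv hz]
    rw [Subgroup.mem_center_iff.1 (hc ⟨z, rfl⟩)]
  have h5 := (h3.congr_of_eventuallyEq hev.symm).unique h4
  have h6 := congrArg (fun L => L x) h5
  rw [← h0]
  simpa using h6

/-- A vector generating a central one-parameter subgroup is central in the Lie algebra. -/
theorem IsLieHom.lie_eq_zero {E : Type*} [NormedAddCommGroup E] [NormedSpace ℝ E]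
    {f : E → G} (hf : IsLieHom d f) (hc : hf.range ≤ Subgroup.center G) (x : E)
    (X Y : GroupLieAlgebra (𝓡 d) G) (hX : derivZero d f x = X) : ⁅X, Y⁆ = 0 := by
  have ha := mem_extChartAt_target (I := 𝓡 d) (1 : G)
  have hev : ∀ᶠ y in 𝓝 (extChartAt (𝓡 d) (1 : G) 1), y ∈ (extChartAt (𝓡 d) (1 : G)).target :=
    extChartAt_target_mem_nhds (1 : G)
  -- Differentiating `1 * z = z` shows that the fields take the values `X` and `Y` at the identity.
  have hone : ∀ Z : EuclideanSpace ℝ (Fin d), fderiv ℝ (localMul d G)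
      (extChartAt (𝓡 d) (1 : G) 1, extChartAt (𝓡 d) (1 : G) 1) (0, Z) = Z := by
    intro Z
    have h1 := ((contDiffAt_localMul ha ha (by simp)).differentiableAt
      (by simp)).hasFDerivAt.comp
        (f := fun z => (extChartAt (𝓡 d) (1 : G) 1, z)) _ (hasFDerivAt_prodMk_right _ _)
    have h2 := h1.congr_of_eventuallyEq (f₁ := id) (by
      filter_upwards [hev] with y hy
      exact (localMul_left_one hy).symm)
    have h3 := congrArg (fun L => L Z) (h2.unique (hasFDerivAt_id _))
    simpa using h3
  rw [GroupLieAlgebra.bracket_def, ← mlieBracketWithin_univ, mlieBracketWithin_apply,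
    preimage_univ, univ_inter, ModelWithCorners.range_eq_univ]
  have key := lieBracket_eq_zero_of_left_eq_right (X := X) (Y := Y)
    ((contDiffAt_localMul ha ha (by simp)).of_le (by exact ENat.LEInfty.out))
    (V := mpullbackWithin 𝓘(ℝ, EuclideanSpace ℝ (Fin d)) (𝓡 d) (extChartAt (𝓡 d) (1 : G)).symm
      (mulInvariantVectorField X) (Set.range (𝓡 d)))
    (W := mpullbackWithin 𝓘(ℝ, EuclideanSpace ℝ (Fin d)) (𝓡 d) (extChartAt (𝓡 d) (1 : G)).symm
      (mulInvariantVectorField Y) (Set.range (𝓡 d)))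
    (by
      filter_upwards [hev] with y hy
      rw [mpullbackWithin_mulInvariantVectorField hy, ← hX]
      -- Centrality enters here: the left-invariant field of `X` is rewritten as a right-invariant
      -- one.
      exact hf.fderiv_localMul_comm hc x hy)
    (by rw [mpullbackWithin_mulInvariantVectorField ha]; exact hone X)
    (by
      filter_upwards [hev] with y hy
      rw [mpullbackWithin_mulInvariantVectorField hy])
    (by rw [mpullbackWithin_mulInvariantVectorField ha]; exact hone Y)
  rw [ModelWithCorners.range_eq_univ] at key
  exact (congrArg (mfderiv (𝓡 d) 𝓘(ℝ, EuclideanSpace ℝ (Fin d))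
    (extChartAt (𝓡 d) (1 : G)) 1).inverse key).trans (_root_.map_zero _)

end Bracket

/-! ### Central tori lie in the nilpotent radical; comparison of the toral components. -/

section Main

/-- The nilradical contains the center. -/
theorem mem_nilradical_of_lie_eq_zero {L : Type*} [LieRing L] [LieAlgebra ℝ L] {X : L}
    (h : ∀ Y : L, ⁅X, Y⁆ = 0) : X ∈ nilradical L := by
  have hc : LieAlgebra.center ℝ L ∈ {J : LieIdeal ℝ L | LieRing.IsNilpotent J} := by
    change LieRing.IsNilpotent (LieAlgebra.center ℝ L)
    infer_instance
  refine le_sSup hc ((LieModule.mem_maxTrivSubmodule ℝ L L X).2 fun Y => ?_)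
  rw [← lie_skew, h, neg_zero]

theorem nilradical_le_radical (L : Type*) [LieRing L] [LieAlgebra ℝ L] :
    nilradical L ≤ LieAlgebra.radical ℝ L := by
  refine sSup_le fun J hJ => le_sSup ?_
  have : LieRing.IsNilpotent J := hJ
  change LieAlgebra.IsSolvable J
  infer_instance

variable {d : ℕ} {G : Type*} [TopologicalSpace G] [ChartedSpace (EuclideanSpace ℝ (Fin d)) G]
  [Group G] [LieGroup (𝓡 d) ∞ G]

/-- Central tori are contained in the nilpotent radical. -/
theorem IsTorus.le_nilpotentRadical {K : Subgroup G} (hK : IsTorus d K)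
    (hc : K ≤ Subgroup.center G) : K ≤ nilpotentRadical d G := by
  obtain ⟨n, f, hf, -, rfl⟩ := hK.exists_isLieHom
  rintro _ ⟨x, rfl⟩
  exact Subgroup.subset_closure
    ⟨_, mem_nilradical_of_lie_eq_zero fun Y => hf.lie_eq_zero hc x _ Y rfl, hf.isExp x⟩

theorem nilpotentRadical_le_solvableRadical : nilpotentRadical d G ≤ solvableRadical d G :=
  Subgroup.closure_mono fun _ ⟨X, hX, h⟩ => ⟨X, nilradical_le_radical _ hX, h⟩

theorem centerOf_top (G : Type*) [Group G] : centerOf (⊤ : Subgroup G) = Subgroup.center G := by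
  ext g
  simp [mem_centerOf, Subgroup.mem_center_iff]

/-- The largest central torus of `G` lies in the nilpotent radical, hence in `H`, and is central
there. Conversely, rigidity makes the toral component of the normal subgroup `H` central in `G`.
Both radicals qualify as `H`. -/
theorem toralComponent_top_eq [ConnectedSpace G] {H : Subgroup G} (hH : H.Normal)
    (hN : nilpotentRadical d G ≤ H) :
    toralComponent d (⊤ : Subgroup G) = toralComponent d H := by
  apply le_antisymm
  · obtain ⟨hT, hTG⟩ := isTorus_toralComponent d (⊤ : Subgroup G)
    rw [centerOf_top] at hTG
    refine hT.le_toralComponent fun g hg => mem_centerOf.2 ⟨hN (hT.le_nilpotentRadical hTG hg), ?_⟩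
    exact fun h _ => Subgroup.mem_center_iff.1 (hTG hg) h
  · refine (isTorus_toralComponent d H).1.le_toralComponent ?_
    rw [centerOf_top]
    exact toralComponent_le_center hH

end Main
end LieToral

end

/-- For a connected Lie group `G`, the maximal torus `T(G)` of its center (which exists) coincides
with the maximal tori of the centers of its solvable and nilpotent radicals. -/
theorem mainTheorem11 {d : ℕ} {G : Type*} [TopologicalSpace G]
    [ChartedSpace (EuclideanSpace ℝ (Fin d)) G] [Group G] [LieGroup (𝓡 d) ∞ G]
    [ConnectedSpace G] :
    LieToral.IsTorus d (LieToral.toralComponent d (⊤ : Subgroup G)) ∧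
    LieToral.toralComponent d (⊤ : Subgroup G) =
      LieToral.toralComponent d (LieToral.solvableRadical d G) ∧
    LieToral.toralComponent d (LieToral.solvableRadical d G) =
      LieToral.toralComponent d (LieToral.nilpotentRadical d G) := by
  have hR := LieToral.toralComponent_top_eq (LieToral.solvableRadical_normal (d := d) (G := G))
    LieToral.nilpotentRadical_le_solvableRadical
  have hN := LieToral.toralComponent_top_eq (LieToral.nilpotentRadical_normal (d := d) (G := G))
    le_rfl
  exact ⟨(LieToral.isTorus_toralComponent d ⊤).1, hR, hR.symm.trans hN⟩
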